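/- **Theorem 3.4.** For a real polynomial $p$, let $N(p;\mathbb C\setminus[0,\infty))$ denote the number of complex zeros of $p$ outside $[0,\infty)$, counted with multiplicity (and $0$ if $p\equiv 0$). Let $\langle f_n\rangle$ be a sequence of real polynomials which converges weakly to a formal power series $f$, that is, for every integer $k\ge 0$ the $k$-th coefficient of $f$ is $\frac1{k!}\lim_{n\to\infty}f_n^{(k)}(0)$ (the limits being assumed to exist). Suppose that some coefficient of $f$ is nonzero and that the sequence $\langle N(f_n;\mathbb C\setminus[0,\infty))\rangle$ is bounded. Then $f$ has infinite radius of convergence, the entire function it represents belongs to $\mathcal{LP}(S_0)^*$, and $f_n\to f$ uniformly on compact subsets of $\mathbb C$. Here $S_0=[0,\infty)$, a real entire function is an entire function that maps $\mathbb R$ into $\mathbb R$, $\mathcal{LP}(S_0)$ is the class of real entire functions of the form $$g(z)=c\,z^m e^{-\alpha z}\prod_j\left(1-\frac{z}{a_j}\right)\qquad(z\in\mathbb C)$$ with $c\in\mathbb R$, $m$ a nonnegative integer, $\alpha\ge 0$, $a_1,a_2,\dots>0$ (finitely many, possibly none, or infinitely many) and $\sum_j a_j^{-1}<\infty$, and $\mathcal{LP}(S_0)^*$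 is the class of real entire functions of the form $Pg$ with $P$ a real polynomial and $g\in\mathcal{LP}(S_0)$. -/

import Mathlib

open Filter Topology Polynomial

/-- The closed half line `S₀ = [0, ∞)`, as a subset of the complex plane. -/
def halfLine : Set ℂ := {z : ℂ | 0 ≤ z.re ∧ z.im = 0}

open Classical in
/-- `N(p; X)`: the number of complex zeros of the real polynomial `p` that lie in `X`, counted
according to their multiplicities; it is `0` if `p` is the zero polynomial (`Polynomial.aroots` is
then the empty multiset). -/
noncomputable def zeroCount (p : ℝ[X]) (X : Set ℂ) : ℕ :=
  (p.aroots ℂ).countP (fun z => z ∈ X)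

/-- A real polynomial as a function on the complex plane. -/
noncomputable def polyFun (p : ℝ[X]) : ℂ → ℂ := fun z => aeval z p

/-- Weak convergence of a sequence of functions (analytic at `0`) to a formal power series: for
every `k` the numbers `f n ^ (k) (0) / k!` converge to the `k`-th coefficient. -/
def ConvergesWeakly (f : ℕ → ℂ → ℂ) (g : PowerSeries ℂ) : Prop :=
  ∀ k : ℕ, Tendsto (fun n => 1 / (k.factorial : ℂ) * iteratedDeriv k (f n) 0) atTop
    (𝓝 (PowerSeries.coeff k g))

/-- Strong convergence: uniform convergence on the compact subsets of the complex plane. -/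
def ConvergesStrongly (f : ℕ → ℂ → ℂ) (g : ℂ → ℂ) : Prop :=
  ∀ K : Set ℂ, IsCompact K → TendstoUniformlyOn f g atTop K

/-- The formal power series `g` has infinite radius of convergence and its sum is `F`. -/
def Represents (g : PowerSeries ℂ) (F : ℂ → ℂ) : Prop :=
  ∀ z : ℂ, HasSum (fun k : ℕ => PowerSeries.coeff k g * z ^ k) (F z)

/-- Real entire functions: entire functions that map the real line into itself. -/
def IsRealEntire (f : ℂ → ℂ) : Prop :=
  Differentiable ℂ f ∧ ∀ x : ℝ, (f x).im = 0

/-- The class `LP(S₀)`: the real entire functions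
`f z = c * z ^ m * exp (-α * z) * ∏ j, (1 - z / a j)` with `c` real, `m` a nonnegative integer,
`α ≥ 0`, all `a j > 0` and `∑ j, 1 / a j < ∞`. The family `a` may be empty, finite or infinite.
The summability makes the product absolutely convergent, see `multipliable_one_sub_div`. -/
def LPHalfLine : Set (ℂ → ℂ) :=
  {f | IsRealEntire f ∧
    ∃ (c : ℝ) (m : ℕ) (α : ℝ) (ι : Type) (_ : Countable ι) (a : ι → ℝ),
      0 ≤ α ∧ (∀ j, 0 < a j) ∧ Summable (fun j => (a j)⁻¹) ∧
      ∀ z : ℂ, f z = c * z ^ m * Complex.exp (-α * z) * ∏' j, (1 - z / a j)}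

/-- The class `LP(S₀)*`: the real entire functions `P * g` with `P` a real polynomial and `g` in
`LP(S₀)`. -/
def LPHalfLineStar : Set (ℂ → ℂ) :=
  {f | IsRealEntire f ∧ ∃ (P : ℝ[X]) (g : ℂ → ℂ), g ∈ LPHalfLine ∧
    ∀ z : ℂ, f z = polyFun P z * g z}

/-- The products in the definition of `LP(S₀)` converge, so that `∏'` has its intended value. -/
theorem multipliable_one_sub_div {ι : Type} {a : ι → ℝ} (ha : ∀ j, 0 < a j)
    (hs : Summable (fun j => (a j)⁻¹)) (z : ℂ) :
    Multipliable (fun j => 1 - z / (a j : ℂ)) := by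
  have h : Summable (fun j => ‖-(z / (a j : ℂ))‖) := by
    refine (hs.mul_left ‖z‖).congr fun j => ?_
    rw [norm_neg, norm_div, Complex.norm_real, Real.norm_of_nonneg (ha j).le, div_eq_mul_inv]
  simpa [sub_eq_add_neg] using multipliable_one_add_of_summable h

/-!
By Rolle's theorem the number of zeros outside `[0, ∞)` does not increase under differentiation,
and translating the zeros to the right does not increase it either. For `p` with `p 0 ≠ 0` write
`p = p 0 * ∏ (1 - u X)`. If the coefficients of `p / p 0` are bounded, Newton's identities bound
the power sums of the `u`. All but at most `B` of the `u` are nonnegative; the directions of the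
others form a point of a compact torus, so some power of bounded exponent brings them all near `1`,
and the corresponding power sum bounds each of them. Hence `∑ |u|` is bounded, and the `k`-th
coefficient of `p` is at most `A T ^ k / k!`. When `p 0` may tend to zero, one first differentiates
as often as the order of `f` at `0`. The coefficient bound gives uniform convergence on compact
sets.

To identify the limit `F`, choose `t > 0` with `F (-t) ≠ 0` and translate `-t` to the origin. The
factors of the products which have nonnegative `u` converge along a subsequence after multiplication
by `e ^ (u z)`, which makes the products converge absolutely given only `u_j = O(1 / j)`; the
remaining factors have bounded degree. Finally `LP(S₀)*` is invariant under real translations.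
-/

section NonnegativeRoots

open Classical in
theorem zeroCount_compl_halfLine_add_countP (p : ℝ[X]) :
    zeroCount p halfLineᶜ + p.roots.countP (0 ≤ ·) = p.natDegree := by
  have hreal : (p.aroots ℂ).filter (· ∈ halfLine) =
      (p.roots.filter (0 ≤ ·)).map ((↑) : ℝ → ℂ) := by
    ext z
    by_cases hz : z ∈ halfLine
    · lift z to ℝ using hz.2
      have hz0 : 0 ≤ z := hz.1
      rw [Multiset.count_map_eq_count' _ _ Complex.ofReal_injective,
        Multiset.count_filter_of_pos hz, Multiset.count_filter_of_pos hz0, aroots_def, count_roots,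
        count_roots]
      exact (eq_rootMultiplicity_map (algebraMap ℝ ℂ).injective z).symm
    · rw [Multiset.count_filter_of_neg hz, eq_comm, Multiset.count_eq_zero]
      rintro h
      obtain ⟨x, hx, rfl⟩ := Multiset.mem_map.1 h
      exact hz ⟨(Multiset.mem_filter.1 hx).2, Complex.ofReal_im x⟩
  have hcount : (p.aroots ℂ).countP (· ∈ halfLine) = p.roots.countP (0 ≤ ·) := by
    rw [Multiset.countP_eq_card_filter, hreal, Multiset.card_map, ← Multiset.countP_eq_card_filter]
  rw [← IsAlgClosed.card_aroots_eq_natDegree (B := ℂ) (p := p),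
    Multiset.card_eq_countP_add_countP (· ∈ halfLine), hcount, add_comm]
  simp only [zeroCount, Set.mem_compl_iff]

theorem countP_roots_le_countP_roots_derivative_add_one {I : Set ℝ} [I.OrdConnected]
    [DecidablePred (· ∈ I)] (p : ℝ[X]) :
    p.roots.countP (· ∈ I) ≤ (derivative p).roots.countP (· ∈ I) + 1 := by
  rcases eq_or_ne (derivative p) 0 with hp' | hp'
  · rw [eq_C_of_derivative_eq_zero hp']
    simp
  have hp : p ≠ 0 := ne_of_apply_ne derivative (by rwa [derivative_zero])
  simp only [Multiset.countP_eq_card_filter]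
  set s := p.roots.filter (· ∈ I)
  set s' := (derivative p).roots.filter (· ∈ I)
  have hmem : ∀ {x}, x ∈ s.toFinset ↔ p.IsRoot x ∧ x ∈ I := by simp [s, hp]
  have hmem' : ∀ {x}, x ∈ s'.toFinset ↔ (derivative p).IsRoot x ∧ x ∈ I := by simp [s', hp']
  have hinterlaced : s.toFinset.card ≤ (s'.toFinset \ s.toFinset).card + 1 := by
    refine Finset.card_le_sdiff_of_interleaved fun x hx y hy hxy _ => ?_
    rw [hmem] at hx hy
    obtain ⟨z, hz, hz'⟩ := exists_deriv_eq_zero hxy p.continuousOn (hx.1.trans hy.1.symm)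
    refine ⟨z, hmem'.2 ⟨?_, Set.OrdConnected.out ‹_› hx.2 hy.2 (Set.Ioo_subset_Icc_self hz)⟩, hz⟩
    rwa [IsRoot, ← p.deriv]
  -- A multiple root loses one multiplicity, and the Rolle points between roots are new roots.
  have hmult : (s - s.dedup) + (s'.toFinset \ s.toFinset).val ≤ s' := by
    refine Multiset.le_iff_count.2 fun x => ?_
    rw [Multiset.count_add, Multiset.count_sub, Multiset.count_dedup]
    by_cases hx : x ∈ s
    · have hxI : x ∈ I := (Multiset.mem_filter.1 hx).2
      have hnot : x ∉ (s'.toFinset \ s.toFinset).val := fun h =>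
        (Finset.mem_sdiff.1 h).2 (Multiset.mem_toFinset.2 hx)
      rw [if_pos hx, Multiset.count_eq_zero_of_notMem hnot, add_zero,
        Multiset.count_filter_of_pos hxI, Multiset.count_filter_of_pos hxI, count_roots,
        count_roots]
      exact rootMultiplicity_sub_one_le_derivative_rootMultiplicity _ _
    · rw [if_neg hx, Multiset.count_eq_zero_of_notMem hx, tsub_zero, zero_add]
      refine Multiset.le_iff_count.1 (le_trans ?_ (Multiset.dedup_le s')) x
      exact Finset.val_le_iff.2 Finset.sdiff_subset
  have hcard := Multiset.card_le_card hmult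
  rw [Multiset.card_add, Multiset.card_sub (Multiset.dedup_le s)] at hcard
  simp only [Finset.card_def, Multiset.toFinset_val] at hinterlaced hcard
  omega

theorem zeroCount_derivative_le (p : ℝ[X]) :
    zeroCount (derivative p) halfLineᶜ ≤ zeroCount p halfLineᶜ := by
  rcases eq_or_ne p.natDegree 0 with hp | hp
  · rw [eq_C_of_natDegree_eq_zero hp, derivative_C]
    simp [zeroCount]
  have hrolle : p.roots.countP (0 ≤ ·) ≤ (derivative p).roots.countP (0 ≤ ·) + 1 :=
    countP_roots_le_countP_roots_derivative_add_one (I := Set.Ici 0) p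
  have hcount := zeroCount_compl_halfLine_add_countP p
  have hcount' := zeroCount_compl_halfLine_add_countP (derivative p)
  have hdeg := natDegree_derivative_lt hp
  omega

theorem zeroCount_taylor_neg_le (p : ℝ[X]) {t : ℝ} (ht : 0 ≤ t) :
    zeroCount (taylor (-t) p) halfLineᶜ ≤ zeroCount p halfLineᶜ := by
  have hroots : (taylor (-t) p).roots = p.roots.map (· + t) := by
    have h := roots_comp_C_mul_X_add_C p 1 (-t) isUnit_one
    simpa [taylor_apply] using h
  have hmono : p.roots.countP (0 ≤ ·) ≤ (taylor (-t) p).roots.countP (0 ≤ ·) := by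
    rw [hroots, Multiset.countP_map, Multiset.countP_eq_card_filter]
    exact Multiset.card_le_card
      (Multiset.monotone_filter_right _ fun x hx => add_nonneg hx ht)
  have hcount := zeroCount_compl_halfLine_add_countP p
  have hcount' := zeroCount_compl_halfLine_add_countP (taylor (-t) p)
  rw [natDegree_taylor] at hcount'
  omega

end NonnegativeRoots

section ReciprocalProducts

/-- The polynomial `∏ (1 - u X)`, the product being taken over a multiset of elements `u`: the
reciprocals of its zeros, padded by zeros. -/
noncomputable def recProd {R : Type*} [CommRing R] (U : Multiset R) : R[X] :=
  (U.map fun u => 1 - C u * X).prod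

variable {R S : Type*} [CommRing R] [CommRing S]

theorem recProd_zero : recProd (0 : Multiset R) = 1 := by
  simp only [recProd, Multiset.map_zero, Multiset.prod_zero]

theorem recProd_cons (u : R) (U : Multiset R) :
    recProd (u ::ₘ U) = (1 - C u * X) * recProd U := by
  simp only [recProd, Multiset.map_cons, Multiset.prod_cons]

theorem recProd_add (U V : Multiset R) : recProd (U + V) = recProd U * recProd V := by
  simp only [recProd, Multiset.map_add, Multiset.prod_add]

theorem map_recProd (φ : R →+* S) (U : Multiset R) : (recProd U).map φ = recProd (U.map φ) := by
  simp [recProd, Polynomial.map_multiset_prod]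

theorem coeff_recProd (U : Multiset R) (k : ℕ) :
    (recProd U).coeff k = (-1) ^ k * U.esymm k := by
  induction U using Multiset.induction_on generalizing k with
  | empty =>
    rw [recProd_zero]
    cases k <;> simp [Multiset.esymm, coeff_one, Multiset.powersetCard_zero_right]
  | cons u U ih =>
    cases k with
    | zero => simp [recProd_cons, mul_coeff_zero, ih, Multiset.esymm]
    | succ k =>
      have hesymm : (u ::ₘ U).esymm (k + 1) = U.esymm (k + 1) + u * U.esymm k := by
        simp [Multiset.esymm, Multiset.powersetCard_cons, Multiset.sum_map_mul_left]
      rw [recProd_cons, sub_mul, one_mul, mul_assoc, coeff_sub, coeff_C_mul, coeff_X_mul, ih, ih,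
        hesymm]
      ring

theorem coeff_zero_recProd (U : Multiset R) : (recProd U).coeff 0 = 1 := by
  simp [coeff_recProd, Multiset.esymm]

theorem prod_X_sub_C_eq_C_mul_recProd {K : Type*} [Field K] {s : Multiset K} (hs : (0 : K) ∉ s) :
    (s.map fun a => X - C a).prod =
      C (s.map fun a => -a).prod * recProd (s.map fun a => a⁻¹) := by
  have hfactor : ∀ a ∈ s, X - C a = C (-a) * (1 - C a⁻¹ * X) := fun a ha => by
    have ha0 : a ≠ 0 := fun h => hs (h ▸ ha)
    rw [mul_sub, ← mul_assoc, ← C_mul, neg_mul, mul_inv_cancel₀ ha0, C_neg, C_neg, C_1]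
    ring
  rw [Multiset.map_congr rfl hfactor, Multiset.prod_map_mul, recProd, Multiset.map_map,
    map_multiset_prod, Multiset.map_map]
  rfl

theorem exists_eq_C_mul_recProd {K : Type*} [Field K] [IsAlgClosed K] {p : K[X]}
    (hp : p.coeff 0 ≠ 0) :
    ∃ W : Multiset K, W.card ≤ p.natDegree ∧ p = C (p.coeff 0) * recProd W := by
  have hp0 : p ≠ 0 := by
    rintro rfl
    exact hp (coeff_zero 0)
  have hroots : (0 : K) ∉ p.roots := fun h => hp (by
    rw [coeff_zero_eq_eval_zero]
    exact (mem_roots hp0).1 h)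
  refine ⟨p.roots.map fun a => a⁻¹, by simpa using p.card_roots', ?_⟩
  have hfactor := (IsAlgClosed.splits p).eq_prod_roots
  rw [prod_X_sub_C_eq_C_mul_recProd hroots, ← mul_assoc, ← C_mul] at hfactor
  have hconst := congrArg (coeff · 0) hfactor
  simp only [coeff_C_mul, coeff_zero_recProd, mul_one] at hconst
  rwa [hconst]

theorem exists_eq_recProd_mul {p : ℝ[X]} (hp : p.coeff 0 ≠ 0) :
    ∃ (Y : Multiset ℝ) (R : ℝ[X]), (∀ y ∈ Y, 0 ≤ y) ∧ R.natDegree ≤ zeroCount p halfLineᶜ ∧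
      p = recProd Y * R := by
  have hp0 : p ≠ 0 := by
    rintro rfl
    exact hp (coeff_zero 0)
  set s := p.roots.filter (0 ≤ ·)
  obtain ⟨Q, hQ⟩ : (s.map fun a => X - C a).prod ∣ p :=
    (Multiset.prod_X_sub_C_dvd_iff_le_roots hp0 s).2 (Multiset.filter_le _ _)
  have hs : (0 : ℝ) ∉ s := fun h => hp (by
    rw [coeff_zero_eq_eval_zero]
    exact (mem_roots hp0).1 (Multiset.mem_of_mem_filter h))
  refine ⟨s.map fun a => a⁻¹, C (s.map fun a => -a).prod * Q, ?_, ?_, ?_⟩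
  · simp only [Multiset.mem_map, forall_exists_index, and_imp, forall_apply_eq_imp_iff₂, inv_nonneg]
    exact fun a ha => (Multiset.mem_filter.1 ha).2
  · have hdeg : p.natDegree = s.card + Q.natDegree := by
      have hQ0 : Q ≠ 0 := right_ne_zero_of_mul (hQ ▸ hp0)
      rw [hQ, Monic.natDegree_mul' (monic_multisetProd_X_sub_C s) hQ0,
        natDegree_multiset_prod_X_sub_C_eq_card]
    have hcount : zeroCount p halfLineᶜ + s.card = p.natDegree := by
      rw [← zeroCount_compl_halfLine_add_countP p, Multiset.countP_eq_card_filter]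
    exact (natDegree_C_mul_le _ _).trans (by omega)
  · rw [hQ, prod_X_sub_C_eq_C_mul_recProd hs]
    ring

end ReciprocalProducts

section Majorization

/-- The sequence `b` is dominated by the Taylor coefficients of the exponential `A exp (T z)`. -/
def ExpMajorized {E : Type*} [Norm E] (A T : ℝ) (b : ℕ → E) : Prop :=
  ∀ k, ‖b k‖ ≤ A * (T ^ k / k.factorial)

theorem hasSum_mul_pow_div_factorial_mul_pow (A T ρ : ℝ) :
    HasSum (fun k : ℕ => A * (T ^ k / k.factorial) * ρ ^ k) (A * Real.exp (T * ρ)) := by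
  have h := (NormedSpace.expSeries_div_hasSum_exp (T * ρ)).mul_left A
  rw [← Real.exp_eq_exp_ℝ] at h
  refine h.congr_fun fun k => ?_
  rw [mul_pow]
  ring

namespace ExpMajorized

variable {A A' T T' : ℝ}

theorem amplitude_nonneg {E : Type*} [SeminormedAddGroup E] {b : ℕ → E}
    (hb : ExpMajorized A T b) : 0 ≤ A := by
  simpa using (norm_nonneg _).trans (hb 0)

theorem mono {E : Type*} [SeminormedAddGroup E] {b : ℕ → E} (hb : ExpMajorized A T b)
    (hA : A ≤ A') (hT₀ : 0 ≤ T) (hT : T ≤ T') : ExpMajorized A' T' b := fun k => by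
  have hA' : 0 ≤ A' := hb.amplitude_nonneg.trans hA
  refine (hb k).trans ?_
  gcongr

theorem of_tendsto {E ι : Type*} [SeminormedAddGroup E] {l : Filter ι} [l.NeBot]
    {f : ι → ℕ → E} {b : ℕ → E} (hb : ∀ k, Tendsto (fun n => f n k) l (𝓝 (b k)))
    (hf : ∀ᶠ n in l, ExpMajorized A T (f n)) : ExpMajorized A T b := fun k =>
  le_of_tendsto (hb k).norm (hf.mono fun _ hn => hn k)

theorem sub {E : Type*} [SeminormedAddGroup E] {b b' : ℕ → E} (hb : ExpMajorized A T b)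
    (hb' : ExpMajorized A' T b') : ExpMajorized (A + A') T (b - b') := fun k => by
  rw [add_mul]
  exact (norm_sub_le _ _).trans (add_le_add (hb k) (hb' k))

theorem mul {R : Type*} [SeminormedRing R] {p q : R[X]} (hp : ExpMajorized A T p.coeff)
    (hq : ExpMajorized A' T' q.coeff) : ExpMajorized (A * A') (T + T') (p * q).coeff := by
  intro k
  have hbinomial : A * A' * ((T + T') ^ k / k.factorial) =
      ∑ ij ∈ Finset.HasAntidiagonal.antidiagonal k,
        A * (T ^ ij.1 / ij.1.factorial) * (A' * (T' ^ ij.2 / ij.2.factorial)) := by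
    rw [(Commute.all T T').add_pow', Finset.sum_div, Finset.mul_sum]
    refine Finset.sum_congr rfl fun ij hij => ?_
    obtain rfl := Finset.HasAntidiagonal.mem_antidiagonal.1 hij
    rw [nsmul_eq_mul, Nat.cast_add_choose]
    field_simp
  rw [coeff_mul, hbinomial]
  refine norm_sum_le_of_le _ fun ij _ => (norm_mul_le _ _).trans ?_
  exact mul_le_mul (hp _) (hq _) (norm_nonneg _) ((norm_nonneg _).trans (hp _))

theorem one_sub_C_mul_X {R : Type*} [NormedCommRing R] [NormOneClass R] (u : R) :
    ExpMajorized 1 ‖u‖ (1 - C u * X : R[X]).coeff := by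
  rintro (_ | _ | k)
  · simp
  · simp [coeff_one]
  · have hcoeff : (1 - C u * X : R[X]).coeff (k + 2) = 0 := by simp [coeff_one]
    rw [hcoeff, norm_zero]
    positivity

theorem recProd {R : Type*} [NormedCommRing R] [NormOneClass R] (U : Multiset R) :
    ExpMajorized 1 (U.map (‖·‖)).sum (recProd U).coeff := by
  induction U using Multiset.induction_on with
  | empty =>
    rintro (_ | k) <;> simp [recProd_zero, coeff_one]
  | cons u U ih =>
    rw [recProd_cons, Multiset.map_cons, Multiset.sum_cons]
    simpa using (one_sub_C_mul_X u).mul ih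

variable {𝕜 : Type*} [RCLike 𝕜]

theorem derivative {p : 𝕜[X]} (hp : ExpMajorized A T p.coeff) :
    ExpMajorized (A * T) T (derivative p).coeff := fun k => by
  have hfactor : A * T * (T ^ k / k.factorial) =
      A * (T ^ (k + 1) / (k + 1).factorial) * (k + 1 : ℕ) := by
    rw [Nat.factorial_succ]
    push_cast
    field_simp
    ring
  rw [coeff_derivative, norm_mul, hfactor, ← Nat.cast_succ, RCLike.norm_natCast]
  gcongr
  exact hp (k + 1)

theorem iterate_derivative {p : 𝕜[X]} (hp : ExpMajorized A T p.coeff) (m : ℕ) :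
    ExpMajorized (A * T ^ m) T (Polynomial.derivative^[m] p).coeff := by
  induction m with
  | zero => simpa using hp
  | succ m ih =>
    rw [Function.iterate_succ_apply', pow_succ, ← mul_assoc]
    exact ih.derivative

theorem of_derivative {p : 𝕜[X]} (hT : 1 ≤ T) (hp₀ : ‖p.coeff 0‖ ≤ A)
    (hp : ExpMajorized A T (Polynomial.derivative p).coeff) : ExpMajorized A T p.coeff := by
  rintro (_ | k)
  · simpa using hp₀
  · have hA : 0 ≤ A := hp.amplitude_nonneg
    have hcoeff := hp k
    rw [coeff_derivative, norm_mul, ← Nat.cast_succ, RCLike.norm_natCast,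
      ← le_div_iff₀ (by positivity)] at hcoeff
    calc ‖p.coeff (k + 1)‖ ≤ A * (T ^ k / k.factorial) / (k + 1 : ℕ) := hcoeff
      _ = A * (T ^ k / (k + 1).factorial) := by
        rw [Nat.factorial_succ]
        push_cast
        field_simp
      _ ≤ A * (T ^ (k + 1) / (k + 1).factorial) := by
        gcongr
        exact k.le_succ

theorem norm_mul_pow_le {b : ℕ → 𝕜} (hb : ExpMajorized A T b) (z : 𝕜) (k : ℕ) :
    ‖b k * z ^ k‖ ≤ A * (T ^ k / k.factorial) * ‖z‖ ^ k := by
  rw [norm_mul, norm_pow]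
  gcongr
  exact hb k

theorem summable {b : ℕ → 𝕜} (hb : ExpMajorized A T b) (z : 𝕜) :
    Summable fun k => b k * z ^ k :=
  (hasSum_mul_pow_div_factorial_mul_pow A T ‖z‖).summable.of_norm_bounded (hb.norm_mul_pow_le z)

theorem norm_eval_le {p : 𝕜[X]} (hp : ExpMajorized A T p.coeff) (z : 𝕜) :
    ‖p.eval z‖ ≤ A * Real.exp (T * ‖z‖) := by
  rw [eval_eq_sum_range]
  refine (norm_sum_le_of_le _ fun k _ => hp.norm_mul_pow_le z k).trans ?_
  exact sum_le_hasSum _ (fun k _ => (norm_nonneg _).trans (hp.norm_mul_pow_le z k))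
    (hasSum_mul_pow_div_factorial_mul_pow A T ‖z‖)

theorem taylor {p : 𝕜[X]} (hp : ExpMajorized A T p.coeff) (r : 𝕜) :
    ExpMajorized (A * Real.exp (T * ‖r‖)) T (taylor r p).coeff := fun k => by
  have hderiv := (hp.iterate_derivative k).norm_eval_le r
  have hfactorial : (Polynomial.derivative^[k] p).eval r =
      k.factorial * (Polynomial.taylor r p).coeff k := by
    rw [taylor_coeff, ← factorial_smul_hasseDeriv]
    simp
  rw [hfactorial, norm_mul, RCLike.norm_natCast] at hderiv
  rw [mul_div_assoc', le_div_iff₀ (by positivity)]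
  linarith

end ExpMajorized

end Majorization

section PowerSums

theorem exists_bound_forall_exists_pow_mem {G : Type*} [Group G] [TopologicalSpace G]
    [IsTopologicalGroup G] [CompactSpace G] {U : Set G} (hU : U ∈ 𝓝 1) :
    ∃ K : ℕ, ∀ g : G, ∃ k, 0 < k ∧ k ≤ K ∧ g ^ k ∈ U := by
  have hreturn (g : G) : ∃ k, 0 < k ∧ g ^ k ∈ interior U := by
    have hfreq := (mapClusterPt_one_atTop_pow g).frequently (interior_mem_nhds.2 hU)
    obtain ⟨k, hmem, hk⟩ := (hfreq.and_eventually (eventually_gt_atTop 0)).exists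
    exact ⟨k, hk, hmem⟩
  choose k hk hkU using hreturn
  obtain ⟨s, hs⟩ := isCompact_univ.elim_finite_subcover
    (fun g : G => (· ^ k g) ⁻¹' interior U)
    (fun g => isOpen_interior.preimage (continuous_pow (k g)))
    fun g _ => Set.mem_iUnion.2 ⟨g, hkU g⟩
  refine ⟨s.sup k, fun g => ?_⟩
  obtain ⟨h, hh, hg⟩ := Set.mem_iUnion₂.1 (hs (Set.mem_univ g))
  exact ⟨k h, hk h, Finset.le_sup hh, interior_subset hg⟩

theorem exists_bound_forall_exists_norm_pow_le_re (B : ℕ) :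
    ∃ K : ℕ, ∀ W : Multiset ℂ, W.card ≤ B →
      ∃ k, 0 < k ∧ k ≤ K ∧ ∀ w ∈ W, ‖w‖ ^ k / 2 ≤ (w ^ k).re := by
  have hU : {g : Fin B → Circle | ∀ i, 1 / 2 < ((g i : Circle) : ℂ).re} ∈ 𝓝 1 := by
    refine IsOpen.mem_nhds ?_ fun _ => by norm_num
    simp only [Set.ofPred_forall]
    exact isOpen_iInter_of_finite fun i => isOpen_lt (by fun_prop) (by fun_prop)
  obtain ⟨K, hK⟩ := exists_bound_forall_exists_pow_mem hU
  refine ⟨K, fun W hW => ?_⟩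
  obtain ⟨k, hk, hkK, hre⟩ :=
    hK fun i => Circle.exp (W.toList.getD i 0).arg
  refine ⟨k, hk, hkK, fun w hw => ?_⟩
  obtain ⟨i, hi, rfl⟩ := List.getElem_of_mem (Multiset.mem_toList.2 hw)
  have hiB : i < B := hi.trans_le ((W.length_toList).trans_le hW)
  have hdir := (hre ⟨i, hiB⟩).le
  set w := W.toList[i]
  have hpow : w ^ k = (‖w‖ ^ k : ℝ) * ((Circle.exp w.arg ^ k : Circle) : ℂ) := by
    conv_lhs => rw [← Complex.norm_mul_exp_arg_mul_I w]
    push_cast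
    rw [mul_pow]
  simp only [Pi.pow_apply, List.getD_eq_getElem _ _ hi] at hdir
  rw [hpow, Complex.re_ofReal_mul, div_eq_mul_one_div]
  gcongr

theorem sum_map_pow_eq {R : Type*} [CommRing R] (U : Multiset R) {k : ℕ} (hk : 0 < k) :
    (U.map (· ^ k)).sum = (-1) ^ (k + 1) * k * U.esymm k -
      ∑ a ∈ Finset.HasAntidiagonal.antidiagonal k with a.1 ∈ Set.Ioo 0 k,
        (-1) ^ a.1 * U.esymm a.1 * (U.map (· ^ a.2)).sum := by
  obtain ⟨l, rfl⟩ : ∃ l : List R, (l : Multiset R) = U := ⟨U.toList, U.coe_toList⟩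
  have hl : (Finset.univ : Finset (Fin l.length)).val.map l.get = l := by simp
  have hpsum (i : ℕ) : MvPolynomial.aeval l.get (MvPolynomial.psum (Fin l.length) R i) =
      (Multiset.map (· ^ i) (l : Multiset R)).sum := by
    rw [MvPolynomial.psum, map_sum, ← hl, Multiset.map_map]
    simp only [map_pow, MvPolynomial.aeval_X]
    rfl
  have hnewton := congrArg (MvPolynomial.aeval l.get)
    (MvPolynomial.psum_eq_mul_esymm_sub_sum (Fin l.length) R k hk)
  simpa only [map_sub, map_sum, map_mul, map_pow, map_neg, map_one, map_natCast, hpsum,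
    MvPolynomial.aeval_esymm_eq_multiset_esymm, hl] using hnewton

theorem exists_bound_norm_sum_map_pow {R : Type*} [NormedCommRing R] [NormOneClass R]
    (c : ℕ → ℝ) {k : ℕ} (hk : 0 < k) :
    ∃ D : ℝ, ∀ U : Multiset R, (∀ i, ‖(recProd U).coeff i‖ ≤ c i) →
      ‖(U.map (· ^ k)).sum‖ ≤ D := by
  induction k using Nat.strong_induction_on with | _ k ih =>
  choose! D hD using ih
  refine ⟨k * c k + ∑ a ∈ Finset.HasAntidiagonal.antidiagonal k with a.1 ∈ Set.Ioo 0 k,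
    c a.1 * D a.2, fun U hU => ?_⟩
  have hc (i : ℕ) : 0 ≤ c i := (norm_nonneg _).trans (hU i)
  have hcoeff (i : ℕ) := hU i
  simp only [coeff_recProd] at hcoeff
  rw [sum_map_pow_eq U hk]
  refine (norm_sub_le _ _).trans (add_le_add ?_ (norm_sum_le_of_le _ fun a ha => ?_))
  · rw [pow_succ, mul_neg_one, neg_mul, neg_mul, norm_neg, mul_comm ((-1) ^ k : R), mul_assoc]
    refine (norm_mul_le _ _).trans ?_
    gcongr
    · simpa using Nat.norm_cast_le (α := R) k
    · exact hcoeff k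
  · obtain ⟨hsum, hpos, hlt⟩ := by
      simpa only [Finset.mem_filter, Finset.HasAntidiagonal.mem_antidiagonal, Set.mem_Ioo] using ha
    refine (norm_mul_le _ _).trans (mul_le_mul (hcoeff _) ?_ (norm_nonneg _) (hc _))
    exact hD a.2 (by omega) (by omega) U hU

theorem exists_bound_norm_of_sum_re_pow_le (B : ℕ) (D : ℕ → ℝ) :
    ∃ A : ℝ, 0 ≤ A ∧ ∀ W : Multiset ℂ, W.card ≤ B →
      (∀ k, 0 < k → (W.map fun w => (w ^ k).re).sum ≤ D k) → ∀ w ∈ W, ‖w‖ ≤ A := by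
  obtain ⟨K, hK⟩ := exists_bound_forall_exists_norm_pow_le_re B
  set Δ : ℝ := ∑ k ∈ Finset.range (K + 1), |D k|
  have hΔ : 0 ≤ Δ := Finset.sum_nonneg fun k _ => abs_nonneg (D k)
  refine ⟨1 + 2 * Δ, by positivity, fun W hW hD w hw => ?_⟩
  obtain ⟨k, hk, hkK, hre⟩ := hK W hW
  have hpow : ‖w‖ ^ k / 2 ≤ Δ := calc
    ‖w‖ ^ k / 2 ≤ (w ^ k).re := hre w hw
    _ ≤ (W.map fun w => (w ^ k).re).sum := by
      refine Multiset.single_le_sum ?_ _ (Multiset.mem_map_of_mem _ hw)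
      simp only [Multiset.mem_map, forall_exists_index, and_imp, forall_apply_eq_imp_iff₂]
      exact fun v hv => le_trans (by positivity) (hre v hv)
    _ ≤ |D k| := (hD k hk).trans (le_abs_self _)
    _ ≤ Δ := Finset.single_le_sum (f := fun k => |D k|) (fun _ _ => abs_nonneg _)
      (Finset.mem_range_succ_iff.2 hkK)
  by_contra! hlt
  have hself : ‖w‖ ≤ ‖w‖ ^ k := le_self_pow₀ (by linarith) hk.ne'
  linarith

theorem exists_bound_sum_add_sum_norm (B : ℕ) (c : ℕ → ℝ) :
    ∃ M : ℝ, 0 ≤ M ∧ ∀ (Y : Multiset ℝ) (W : Multiset ℂ), (∀ y ∈ Y, 0 ≤ y) → W.card ≤ B →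
      (∀ k, ‖(recProd (Y.map Complex.ofReal + W)).coeff k‖ ≤ c k) →
      Y.sum + (W.map (‖·‖)).sum ≤ M := by
  have hpower (k : ℕ) (hk : 0 < k) := exists_bound_norm_sum_map_pow (R := ℂ) c hk
  choose! D hD using hpower
  obtain ⟨A, hA, hWA⟩ := exists_bound_norm_of_sum_re_pow_le B D
  refine ⟨|D 1| + 2 * (B * A), by positivity, fun Y W hY hW hc => ?_⟩
  have hre (k : ℕ) (hk : 0 < k) :
      (Y.map (· ^ k)).sum + (W.map fun w => (w ^ k).re).sum ≤ D k := by
    have hle := (Complex.re_le_norm _).trans (hD k hk _ hc)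
    rw [← Complex.coe_reAddGroupHom, map_multiset_sum, Multiset.map_map, Multiset.map_add,
      Multiset.sum_add, Multiset.map_map] at hle
    simpa [← Complex.ofReal_pow] using hle
  have hYpow (k : ℕ) : 0 ≤ (Y.map (· ^ k)).sum := Multiset.sum_nonneg fun x hx => by
    obtain ⟨y, hy, rfl⟩ := Multiset.mem_map.1 hx
    exact pow_nonneg (hY y hy) k
  have hWnorm : (W.map (‖·‖)).sum ≤ B * A := by
    have hle : ∀ x ∈ W.map (‖·‖), x ≤ A := by
      simpa only [Multiset.mem_map, forall_exists_index, and_imp, forall_apply_eq_imp_iff₂] using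
        hWA W hW fun k hk => by linarith [hre k hk, hYpow k]
    refine (Multiset.sum_le_card_nsmul _ A hle).trans ?_
    rw [Multiset.card_map, nsmul_eq_mul]
    gcongr
  have hWre : -(W.map (‖·‖)).sum ≤ (W.map Complex.re).sum := by
    rw [← Multiset.sum_map_neg', Multiset.map_map]
    exact Multiset.sum_map_le_sum_map _ _ fun w _ => neg_le_of_abs_le (Complex.abs_re_le_norm w)
  have hone := hre 1 one_pos
  simp only [pow_one, Multiset.map_id'] at hone
  linarith [le_abs_self (D 1)]

end PowerSums

section CoefficientBounds

theorem exists_bound_normalized_factorization (B : ℕ) (c : ℕ → ℝ) :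
    ∃ M : ℝ, 0 ≤ M ∧ ∀ p : ℝ[X], zeroCount p halfLineᶜ ≤ B → p.coeff 0 ≠ 0 →
      (∀ k, |p.coeff k| ≤ c k * |p.coeff 0|) →
      ∃ (Y : Multiset ℝ) (R : ℝ[X]), (∀ y ∈ Y, 0 ≤ y) ∧ Y.sum ≤ M ∧ R.natDegree ≤ B ∧
        p = recProd Y * R ∧ ExpMajorized |p.coeff 0| M R.coeff := by
  obtain ⟨M, hM, hbound⟩ := exists_bound_sum_add_sum_norm B c
  refine ⟨M, hM, fun p hpB hp0 hc => ?_⟩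
  obtain ⟨Y, R, hY, hR, hp⟩ := exists_eq_recProd_mul hp0
  have hR0 : R.coeff 0 = p.coeff 0 := by
    rw [hp, mul_coeff_zero, coeff_zero_recProd, one_mul]
  obtain ⟨W, hW, hRW⟩ := exists_eq_C_mul_recProd (p := R.map (algebraMap ℝ ℂ)) (by simpa [hR0])
  rw [natDegree_map] at hW
  have hmap : p.map (algebraMap ℝ ℂ) =
      C ((p.coeff 0 : ℝ) : ℂ) * recProd (Y.map Complex.ofReal + W) := by
    nth_rw 1 [hp]
    rw [Polynomial.map_mul, map_recProd, hRW, recProd_add, coeff_map, hR0, Complex.coe_algebraMap]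
    ring
  have hUc (k : ℕ) : ‖(recProd (Y.map Complex.ofReal + W)).coeff k‖ ≤ c k := by
    have hcoeff : |p.coeff k| = ‖(recProd (Y.map Complex.ofReal + W)).coeff k‖ * |p.coeff 0| := by
      simpa [mul_comm] using congrArg (fun q => ‖coeff q k‖) hmap
    exact le_of_mul_le_mul_right (hcoeff ▸ hc k) (abs_pos.2 hp0)
  have hsum := hbound Y W hY (hW.trans (hR.trans hpB)) hUc
  have hY' : 0 ≤ Y.sum := Multiset.sum_nonneg hY
  have hW' : 0 ≤ (W.map (‖·‖)).sum := Multiset.sum_nonneg (by simp)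
  refine ⟨Y, R, hY, by linarith, hR.trans hpB, hp, fun k => ?_⟩
  have hRk : ‖R.coeff k‖ = |p.coeff 0| * ‖(recProd W).coeff k‖ := by
    simpa [hR0] using congrArg (fun q => ‖coeff q k‖) hRW
  have hWk := (ExpMajorized.recProd W).mono le_rfl hW' (by linarith : _ ≤ M) k
  rw [hRk]
  gcongr
  simpa using hWk

theorem exists_bound_expMajorized (B : ℕ) (c : ℕ → ℝ) :
    ∃ T : ℝ, 1 ≤ T ∧ ∀ p : ℝ[X], zeroCount p halfLineᶜ ≤ B → p.coeff 0 ≠ 0 →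
      (∀ k, |p.coeff k| ≤ c k * |p.coeff 0|) → ExpMajorized |p.coeff 0| T p.coeff := by
  obtain ⟨M, hM, hfactor⟩ := exists_bound_normalized_factorization B c
  refine ⟨1 + 2 * M, by linarith, fun p hpB hp0 hc => ?_⟩
  obtain ⟨Y, R, hY, hYM, -, hp, hR⟩ := hfactor p hpB hp0 hc
  have hYnorm : (Y.map (‖·‖)).sum = Y.sum := by
    rw [Multiset.map_congr rfl fun y hy => Real.norm_of_nonneg (hY y hy), Multiset.map_id']
  have hmul := (ExpMajorized.recProd Y).mul hR
  rw [← hp, one_mul, hYnorm] at hmul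
  have hYsum : 0 ≤ Y.sum := Multiset.sum_nonneg hY
  exact hmul.mono le_rfl (by linarith) (by linarith)

theorem exists_eventually_expMajorized {B : ℕ} {f : ℕ → ℝ[X]} {b : ℕ → ℂ}
    (hB : ∀ n, zeroCount (f n) halfLineᶜ ≤ B)
    (hb : ∀ k, Tendsto (fun n => ((f n).coeff k : ℂ)) atTop (𝓝 (b k)))
    {m : ℕ} (hm : b m ≠ 0) :
    ∃ A T : ℝ, 1 ≤ T ∧ ∀ᶠ n in atTop, ExpMajorized A T (f n).coeff := by
  have hbounded (k : ℕ) : ∃ c, ∀ n, |(f n).coeff k| ≤ c := by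
    obtain ⟨c, hc⟩ := (hb k).norm.bddAbove_range
    exact ⟨c, fun n => by simpa using hc ⟨n, rfl⟩⟩
  choose c hc using hbounded
  have hc_nonneg (k : ℕ) : 0 ≤ c k := (abs_nonneg _).trans (hc k 0)
  induction m generalizing f b c with
  | zero =>
    set δ := ‖b 0‖ / 2
    have hδ : 0 < δ := half_pos (norm_pos_iff.2 hm)
    obtain ⟨T, hT, hmaj⟩ := exists_bound_expMajorized B fun k => c k / δ
    refine ⟨c 0, T, hT, ?_⟩
    filter_upwards [(hb 0).norm.eventually_const_le (half_lt_self (norm_pos_iff.2 hm))] with n hn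
    rw [Complex.norm_real, Real.norm_eq_abs] at hn
    refine (hmaj (f n) (hB n) (abs_pos.1 (hδ.trans_le hn)) fun k => ?_).mono (hc 0 n)
      (by linarith) le_rfl
    rw [div_mul_eq_mul_div, le_div_iff₀ hδ]
    exact mul_le_mul (hc k n) hn hδ.le (hc_nonneg k)
  | succ m ih =>
    obtain ⟨A, T, hT, hmaj⟩ := ih (f := fun n => derivative (f n))
      (b := fun k => b (k + 1) * (k + 1)) (fun n => (zeroCount_derivative_le (f n)).trans (hB n))
      (fun k => by simpa [coeff_derivative] using (hb (k + 1)).mul_const (k + 1 : ℂ))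
      (mul_ne_zero hm m.cast_add_one_ne_zero) (fun k => c (k + 1) * (k + 1))
      (fun k n => by
        rw [coeff_derivative, abs_mul, abs_of_nonneg (by positivity : (0 : ℝ) ≤ k + 1)]
        gcongr
        exact hc _ n)
      (fun k => mul_nonneg (hc_nonneg _) (by positivity))
    refine ⟨max A (c 0), T, hT, hmaj.mono fun n hn => ?_⟩
    exact .of_derivative hT ((hc 0 n).trans (le_max_right _ _))
      (hn.mono (le_max_left _ _) (by linarith) le_rfl)

end CoefficientBounds

section PowerSeriesLimits

theorem tendstoUniformlyOn_tsum_of_expMajorized {ι 𝕜 : Type*} [RCLike 𝕜] {l : Filter ι} [l.NeBot]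
    {a : ι → ℕ → 𝕜} {b : ℕ → 𝕜} {A T : ℝ} {K : Set 𝕜}
    (hb : ∀ k, Tendsto (fun n => a n k) l (𝓝 (b k)))
    (ha : ∀ᶠ n in l, ExpMajorized A T (a n)) (hK : Bornology.IsBounded K) :
    TendstoUniformlyOn (fun n z => ∑' k, a n k * z ^ k) (fun z => ∑' k, b k * z ^ k) l K := by
  have hbA : ExpMajorized A T b := .of_tendsto hb ha
  obtain ⟨r, hr, hKr⟩ := hK.exists_pos_norm_le
  have hdom := (hasSum_mul_pow_div_factorial_mul_pow (A + A) T r).summable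
  have hmaj : ∀ᶠ n in l, ∀ k,
      ‖‖a n k - b k‖ * r ^ k‖ ≤ (A + A) * (T ^ k / k.factorial) * r ^ k := by
    filter_upwards [ha] with n hn k
    rw [Real.norm_of_nonneg (by positivity)]
    gcongr
    exact hn.sub hbA k
  have hlim : Tendsto (fun n => ∑' k, ‖a n k - b k‖ * r ^ k) l (𝓝 0) := by
    simpa using tendsto_tsum_of_dominated_convergence hdom
      (fun k => (((hb k).sub_const _).norm).mul_const _) hmaj
  rw [Metric.tendstoUniformlyOn_iff]
  intro ε hε
  filter_upwards [ha, hmaj, hlim.eventually_lt_const hε] with n hn hnmaj hnε z hz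
  rw [dist_comm, dist_eq_norm, ← (hn.summable z).tsum_sub (hbA.summable z)]
  refine (tsum_of_norm_bounded (hdom.of_norm_bounded hnmaj).hasSum fun k => ?_).trans_lt hnε
  rw [← sub_mul, norm_mul, norm_pow]
  gcongr
  exact hKr z hz

theorem iteratedDeriv_polyFun (p : ℝ[X]) (k : ℕ) :
    iteratedDeriv k (polyFun p) = polyFun (derivative^[k] p) := by
  induction k with
  | zero => rw [iteratedDeriv_zero, Function.iterate_zero_apply]
  | succ k ih =>
    rw [iteratedDeriv_succ, ih, Function.iterate_succ_apply']
    ext z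
    exact Polynomial.deriv_aeval _

theorem inv_factorial_mul_iteratedDeriv_polyFun (p : ℝ[X]) (k : ℕ) :
    1 / (k.factorial : ℂ) * iteratedDeriv k (polyFun p) 0 = p.coeff k := by
  have hk : (k.factorial : ℂ) ≠ 0 := by exact_mod_cast k.factorial_ne_zero
  rw [iteratedDeriv_polyFun, polyFun, ← coeff_zero_eq_aeval_zero', coeff_iterate_derivative,
    zero_add, Nat.descFactorial_self, nsmul_eq_mul, Complex.coe_algebraMap, Complex.ofReal_mul,
    Complex.ofReal_natCast]
  field_simp

theorem hasSum_polyFun (p : ℝ[X]) (z : ℂ) :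
    HasSum (fun k => (p.coeff k : ℂ) * z ^ k) (polyFun p z) := by
  rw [polyFun, aeval_eq_sum_range]
  simp only [Complex.real_smul]
  refine hasSum_sum_of_ne_finset_zero fun k hk => ?_
  rw [coeff_eq_zero_of_natDegree_lt (by simpa using hk), Complex.ofReal_zero, zero_mul]

theorem convergesWeakly_polyFun_iff {f : ℕ → ℝ[X]} {g : PowerSeries ℂ} :
    ConvergesWeakly (fun n => polyFun (f n)) g ↔
      ∀ k, Tendsto (fun n => ((f n).coeff k : ℂ)) atTop (𝓝 (PowerSeries.coeff k g)) := by
  simp only [ConvergesWeakly, inv_factorial_mul_iteratedDeriv_polyFun]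

theorem ExpMajorized.exists_represents_convergesStrongly {f : ℕ → ℝ[X]} {g : PowerSeries ℂ}
    {A T : ℝ} (hg : ConvergesWeakly (fun n => polyFun (f n)) g)
    (hf : ∀ᶠ n in atTop, ExpMajorized A T (f n).coeff) :
    ∃ F, Represents g F ∧ ConvergesStrongly (fun n => polyFun (f n)) F := by
  rw [convergesWeakly_polyFun_iff] at hg
  have hf' : ∀ᶠ n in atTop, ExpMajorized A T fun k => ((f n).coeff k : ℂ) :=
    hf.mono fun n hn k => (Complex.norm_real _).trans_le (hn k)
  refine ⟨fun z => ∑' k, PowerSeries.coeff k g * z ^ k,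
    fun z => ((ExpMajorized.of_tendsto hg hf').summable z).hasSum, fun K hK => ?_⟩
  simpa only [(hasSum_polyFun _ _).tsum_eq] using
    tendstoUniformlyOn_tsum_of_expMajorized hg hf' hK.isBounded

end PowerSeriesLimits

section LaguerrePolya

theorem multipliable_one_sub_mul {ι R : Type*} [NormedCommRing R] [NormOneClass R]
    [CompleteSpace R] {x : ι → R} (hx : Summable fun j => ‖x j‖) (z : R) :
    Multipliable fun j => 1 - x j * z := by
  have hsum : Summable fun j => ‖-(x j * z)‖ :=
    (hx.mul_right ‖z‖).of_nonneg_of_le (fun _ => norm_nonneg _) fun j => by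
      simpa only [norm_neg] using norm_mul_le (x j) z
  simpa only [sub_eq_add_neg] using multipliable_one_add_of_summable hsum

theorem differentiable_tprod_one_sub_mul {ι : Type*} {x : ι → ℂ} (hx : Summable fun j => ‖x j‖) :
    Differentiable ℂ fun z : ℂ => ∏' j, (1 - x j * z) := by
  intro z
  have hz : z ∈ Metric.ball (0 : ℂ) (‖z‖ + 1) := by simp
  have hlimit := Summable.hasProdLocallyUniformlyOn_one_add (f := fun j (z : ℂ) => -(x j * z))
    Metric.isOpen_ball (hx.mul_right (‖z‖ + 1))
    (Eventually.of_forall fun j w hw => by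
      rw [norm_neg, norm_mul]
      gcongr
      exact (mem_ball_zero_iff.1 hw).le) fun j => by fun_prop
  have hdiff := hlimit.differentiableOn (.of_forall fun s => by
    simpa only [Finset.prod_fn] using DifferentiableOn.finsetProd fun _ _ => by fun_prop)
    Metric.isOpen_ball
  simpa only [sub_eq_add_neg] using hdiff.differentiableAt (Metric.isOpen_ball.mem_nhds hz)

theorem IsRealEntire.mul {f g : ℂ → ℂ} (hf : IsRealEntire f) (hg : IsRealEntire g) :
    IsRealEntire fun z => f z * g z :=
  ⟨hf.1.mul hg.1, fun x => by
    rw [Complex.mul_im, hf.2 x, hg.2 x, mul_zero, zero_mul, add_zero]⟩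

theorem isRealEntire_polyFun (p : ℝ[X]) : IsRealEntire (polyFun p) :=
  ⟨fun _ => p.differentiableAt_aeval, fun x => by
    rw [polyFun, ← Complex.coe_algebraMap, aeval_algebraMap_apply]
    exact Complex.ofReal_im _⟩

theorem isRealEntire_exp_mul (α : ℝ) : IsRealEntire fun z => Complex.exp (α * z) :=
  ⟨by fun_prop, fun x => by
    simp only [← Complex.ofReal_mul, Complex.exp_ofReal_im]⟩

theorem ofReal_tprod_one_sub_mul {ι : Type*} {x : ι → ℝ} (hx : Summable x) (r : ℝ) :
    ((∏' j, (1 - x j * r) : ℝ) : ℂ) = ∏' j, (1 - (x j : ℂ) * r) := by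
  rw [← Complex.ofRealHom_eq_coe,
    (multipliable_one_sub_mul hx.norm r).map_tprod Complex.ofRealHom Complex.continuous_ofReal]
  simp

theorem isRealEntire_tprod_one_sub_mul {ι : Type*} {x : ι → ℝ} (hx : Summable x) :
    IsRealEntire fun z => ∏' j, (1 - (x j : ℂ) * z) :=
  ⟨differentiable_tprod_one_sub_mul (by simpa using hx.norm), fun r => by
    simp only [← ofReal_tprod_one_sub_mul hx, Complex.ofReal_im]⟩

theorem exp_mul_tprod_mem_LPHalfLine {ι : Type} {α : ℝ} {x : ι → ℝ} (hα : 0 ≤ α)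
    (hx₀ : ∀ j, 0 ≤ x j) (hx : Summable x) :
    (fun z => Complex.exp (-α * z) * ∏' j, (1 - (x j : ℂ) * z)) ∈ LPHalfLine := by
  refine ⟨?_, 1, 0, α, Function.support x, hx.countable_support.to_subtype, fun j => (x j)⁻¹, hα,
    fun j => inv_pos.2 ((hx₀ j).lt_of_ne' j.2), ?_, fun z => ?_⟩
  · simpa using (isRealEntire_exp_mul (-α)).mul (isRealEntire_tprod_one_sub_mul hx)
  · simp only [inv_inv]
    exact hx.comp_injective Subtype.val_injective
  · have hsupport : (Function.mulSupport fun j => 1 - (x j : ℂ) * z) ⊆ Function.support x :=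
      fun j hj hxj => hj (by simp [hxj])
    simp only [← tprod_subtype_eq_of_mulSupport_subset hsupport]
    simp [div_eq_mul_inv, mul_comm]

theorem mem_LPHalfLineStar_iff {F : ℂ → ℂ} :
    F ∈ LPHalfLineStar ↔ ∃ (P : ℝ[X]) (α : ℝ) (ι : Type) (x : ι → ℝ), 0 ≤ α ∧ (∀ j, 0 ≤ x j) ∧
      Summable x ∧ ∀ z, F z = polyFun P z * (Complex.exp (-α * z) * ∏' j, (1 - x j * z)) := by
  constructor
  · rintro ⟨-, P, g, ⟨-, c, m, α, ι, -, a, hα, ha, hsum, hg⟩, hF⟩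
    refine ⟨P * (C c * X ^ m), α, ι, fun j => (a j)⁻¹, hα, fun j => (inv_pos.2 (ha j)).le, hsum,
      fun z => ?_⟩
    simp [hF, hg, polyFun, div_eq_inv_mul, mul_assoc]
  · rintro ⟨P, α, ι, x, hα, hx₀, hx, hF⟩
    have hg := exp_mul_tprod_mem_LPHalfLine hα hx₀ hx
    obtain rfl := funext hF
    exact ⟨(isRealEntire_polyFun P).mul hg.1, P, _, hg, fun z => rfl⟩

end LaguerrePolya

section Translation

theorem polyFun_taylor (p : ℝ[X]) (t : ℝ) (z : ℂ) :
    polyFun (taylor t p) z = polyFun p (z + t) := by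
  simp [polyFun, taylor_apply, aeval_comp]

theorem exists_tprod_one_sub_mul_add_eq {ι : Type*} {x : ι → ℝ} (hx₀ : ∀ j, 0 ≤ x j)
    (hx : Summable x) {t : ℝ} (ht : ∀ j, x j * t ≤ 1 / 2) :
    ∃ (κ : ℝ) (y : ι → ℝ), (∀ j, 0 ≤ y j) ∧ Summable y ∧
      ∀ z : ℂ, ∏' j, (1 - x j * (z + t)) = κ * ∏' j, (1 - y j * z) := by
  have hpos (j : ι) : 0 < 1 - x j * t := by linarith [ht j]
  set y : ι → ℝ := fun j => x j / (1 - x j * t)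
  have hy₀ (j : ι) : 0 ≤ y j := div_nonneg (hx₀ j) (hpos j).le
  have hy : Summable y := by
    refine (hx.mul_left 2).of_nonneg_of_le hy₀ fun j => ?_
    rw [div_le_iff₀ (hpos j)]
    nlinarith [hx₀ j, ht j]
  refine ⟨∏' j, (1 - x j * t), y, hy₀, hy, fun z => ?_⟩
  rw [ofReal_tprod_one_sub_mul hx, ← Multipliable.tprod_mul
    (multipliable_one_sub_mul (by simpa using hx.norm) _)
    (multipliable_one_sub_mul (by simpa using hy.norm) _)]
  refine tprod_congr fun j => ?_
  have hne : (1 - x j * t : ℂ) ≠ 0 := by exact_mod_cast (hpos j).ne'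
  simp only [y]
  push_cast
  field_simp
  ring

theorem exists_tprod_one_sub_mul_add_eq_polyFun_mul {ι : Type*} {x : ι → ℝ} (hx₀ : ∀ j, 0 ≤ x j)
    (hx : Summable x) (t : ℝ) :
    ∃ (Q : ℝ[X]) (s : Set ι) (y : s → ℝ), (∀ j, 0 ≤ y j) ∧ Summable y ∧
      ∀ z : ℂ, ∏' j, (1 - x j * (z + t)) = polyFun Q z * ∏' j, (1 - y j * z) := by
  set s : Set ι := {j | x j * t ≤ 1 / 2}
  have hfinite : sᶜ.Finite := by
    have hlim : Tendsto (fun j => x j * t) cofinite (𝓝 0) := by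
      simpa using hx.tendsto_cofinite_zero.mul_const t
    exact hlim.eventually_le_const one_half_pos
  have : Fintype ↥sᶜ := hfinite.fintype
  have hxs : Summable fun j : s => x j := hx.comp_injective Subtype.val_injective
  obtain ⟨κ, y, hy₀, hy, hprod⟩ :=
    exists_tprod_one_sub_mul_add_eq (fun j : s => hx₀ j) hxs fun j => j.2
  refine ⟨C κ * ∏ j : ↥sᶜ, (1 - C (x j) * (X + C t)), s, y, hy₀, hy, fun z => ?_⟩
  have hsplit := Multipliable.tprod_mul_tprod_compl (f := fun j => 1 - (x j : ℂ) * (z + t))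
    (multipliable_one_sub_mul (by simpa using hxs.norm) _) (hfinite.multipliable _)
  rw [← hsplit, hprod, tprod_fintype (β := ↥sᶜ)]
  simp only [polyFun, map_mul, map_prod, map_sub, map_add, map_one, aeval_C, aeval_X,
    Complex.coe_algebraMap]
  ring

theorem comp_add_mem_LPHalfLineStar {F : ℂ → ℂ} (hF : F ∈ LPHalfLineStar) (t : ℝ) :
    (fun z => F (z + t)) ∈ LPHalfLineStar := by
  obtain ⟨P, α, ι, x, hα, hx₀, hx, hF⟩ := mem_LPHalfLineStar_iff.1 hF
  obtain ⟨Q, s, y, hy₀, hy, hshift⟩ := exists_tprod_one_sub_mul_add_eq_polyFun_mul hx₀ hx t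
  refine mem_LPHalfLineStar_iff.2
    ⟨taylor t P * C (Real.exp (-α * t)) * Q, α, s, y, hα, hy₀, hy, fun z => ?_⟩
  have hpoly : polyFun (taylor t P * C (Real.exp (-α * t)) * Q) z =
      polyFun P (z + t) * Complex.exp (-α * t) * polyFun Q z := by
    rw [← polyFun_taylor]
    simp [polyFun]
  rw [hF, hshift, hpoly, mul_add, Complex.exp_add]
  ring

end Translation

section DecreasingEnumeration

/-- The decreasing enumeration of a finite multiset of real numbers, padded by zeros. -/
noncomputable def decreasingSeq (Y : Multiset ℝ) (j : ℕ) : ℝ :=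
  (Y.sort (· ≥ ·)).getD j 0

variable {Y : Multiset ℝ}

theorem decreasingSeq_of_card_le {j : ℕ} (hj : Y.card ≤ j) : decreasingSeq Y j = 0 :=
  List.getD_eq_default _ _ (by rwa [Multiset.length_sort])

theorem decreasingSeq_nonneg (hY : ∀ y ∈ Y, 0 ≤ y) (j : ℕ) : 0 ≤ decreasingSeq Y j := by
  rcases lt_or_ge j (Y.sort (· ≥ ·)).length with hj | hj
  · rw [decreasingSeq, List.getD_eq_getElem _ _ hj]
    exact hY _ ((Multiset.mem_sort _).1 (List.getElem_mem hj))
  · exact (List.getD_eq_default _ _ hj).ge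

theorem antitone_decreasingSeq (hY : ∀ y ∈ Y, 0 ≤ y) : Antitone (decreasingSeq Y) := by
  intro i j hij
  rcases lt_or_ge j (Y.sort (· ≥ ·)).length with hj | hj
  · rw [decreasingSeq, decreasingSeq, List.getD_eq_getElem _ _ hj,
      List.getD_eq_getElem _ _ (hij.trans_lt hj)]
    exact (Multiset.pairwise_sort Y (· ≥ ·)).rel_get_of_le (a := ⟨i, hij.trans_lt hj⟩)
      (b := ⟨j, hj⟩) hij
  · exact (List.getD_eq_default _ _ hj).le.trans (decreasingSeq_nonneg hY i)

@[to_additive]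
theorem prod_range_getD {α M : Type*} [CommMonoid M] (l : List α) (a : α) (f : α → M) :
    ∏ j ∈ Finset.range l.length, f (l.getD j a) = (l.map f).prod := by
  induction l with
  | nil => simp
  | cons b l ih => simp [Finset.prod_range_succ', ← ih, mul_comm]

@[to_additive]
theorem prod_range_decreasingSeq {M : Type*} [CommMonoid M] (Y : Multiset ℝ) (f : ℝ → M) :
    ∏ j ∈ Finset.range Y.card, f (decreasingSeq Y j) = (Y.map f).prod := by
  have hsort := prod_range_getD (Y.sort (· ≥ ·)) 0 f
  rwa [Multiset.length_sort, ← Multiset.prod_coe, ← Multiset.map_coe, Multiset.sort_eq] at hsort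

theorem hasSum_decreasingSeq (Y : Multiset ℝ) : HasSum (decreasingSeq Y) Y.sum := by
  have hsum := sum_range_decreasingSeq Y id
  rw [Multiset.map_id] at hsum
  rw [← hsum]
  exact hasSum_sum_of_ne_finset_zero fun j hj =>
    decreasingSeq_of_card_le (by simpa using hj)

theorem decreasingSeq_le_sum_div (hY : ∀ y ∈ Y, 0 ≤ y) (j : ℕ) :
    decreasingSeq Y j ≤ Y.sum / (j + 1) := by
  rw [le_div_iff₀ (by positivity)]
  calc decreasingSeq Y j * (j + 1) = ∑ _i ∈ Finset.range (j + 1), decreasingSeq Y j := by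
        simp [mul_comm]
    _ ≤ ∑ i ∈ Finset.range (j + 1), decreasingSeq Y i := Finset.sum_le_sum fun i hi =>
        antitone_decreasingSeq hY (Nat.lt_succ_iff.1 (Finset.mem_range.1 hi))
    _ ≤ Y.sum := sum_le_hasSum _ (fun i _ => decreasingSeq_nonneg hY i) (hasSum_decreasingSeq Y)

theorem polyFun_recProd (Y : Multiset ℝ) (z : ℂ) :
    polyFun (recProd Y) z = ∏' j, (1 - decreasingSeq Y j * z) := by
  rw [tprod_eq_prod (s := Finset.range Y.card) fun j hj => by
      rw [decreasingSeq_of_card_le (by simpa using hj), Complex.ofReal_zero, zero_mul, sub_zero],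
    prod_range_decreasingSeq Y fun y => 1 - (y : ℂ) * z, polyFun, recProd, map_multiset_prod,
    Multiset.map_map]
  simp

end DecreasingEnumeration

section PrimaryFactors

/-- The Weierstrass primary factor of genus one, `(1 - u) e ^ u`. -/
noncomputable def primaryFactor (u : ℂ) : ℂ :=
  (1 - u) * Complex.exp u

theorem norm_primaryFactor_sub_one_le (u : ℂ) :
    ‖primaryFactor u - 1‖ ≤ 3 * Real.exp ‖u‖ * ‖u‖ ^ 2 := by
  have hexp : 1 ≤ Real.exp ‖u‖ := Real.one_le_exp (norm_nonneg u)
  rcases le_total ‖u‖ 1 with hu | hu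
  · calc ‖primaryFactor u - 1‖ = ‖(Complex.exp u - 1 - u) - u * (Complex.exp u - 1)‖ := by
          rw [primaryFactor]
          ring_nf
      _ ≤ ‖u‖ ^ 2 + ‖u‖ * (2 * ‖u‖) := by
          refine (norm_sub_le _ _).trans ?_
          rw [norm_mul]
          gcongr
          exacts [Complex.norm_exp_sub_one_sub_id_le hu, Complex.norm_exp_sub_one_le hu]
      _ ≤ 3 * Real.exp ‖u‖ * ‖u‖ ^ 2 := by nlinarith [sq_nonneg ‖u‖]
  · calc ‖primaryFactor u - 1‖ ≤ (1 + ‖u‖) * Real.exp ‖u‖ + 1 := by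
          refine (norm_sub_le _ _).trans ?_
          rw [primaryFactor, norm_mul, norm_one]
          gcongr
          · exact (norm_sub_le _ _).trans_eq (by rw [norm_one])
          · exact Complex.norm_exp_le_exp_norm u
      _ ≤ 3 * Real.exp ‖u‖ * ‖u‖ ^ 2 := by
          nlinarith [mul_nonneg (sub_nonneg.2 hu) (sub_nonneg.2 hexp),
            mul_le_mul_of_nonneg_left hu (norm_nonneg u)]

theorem tendsto_tprod_primaryFactor {y : ℕ → ℕ → ℝ} {x : ℕ → ℝ} {M : ℝ}
    (hy₀ : ∀ n j, 0 ≤ y n j) (hyM : ∀ n j, y n j ≤ M / (j + 1))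
    (hyx : ∀ j, Tendsto (fun n => y n j) atTop (𝓝 (x j))) (z : ℂ) :
    Tendsto (fun n => ∏' j, primaryFactor (y n j * z)) atTop
      (𝓝 (∏' j, primaryFactor (x j * z))) := by
  have hM : 0 ≤ M := by simpa using (hy₀ 0 0).trans (hyM 0 0)
  have hmajorant : Summable fun j : ℕ =>
      3 * Real.exp (M * ‖z‖) * ((M * ‖z‖) ^ 2 * (1 / ((j : ℝ) + 1) ^ 2)) := by
    refine (Summable.mul_left _ ?_).mul_left _
    exact_mod_cast (summable_nat_add_iff 1).2 (Real.summable_one_div_nat_pow.2 one_lt_two)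
  have hfactor (j : ℕ) : Tendsto (fun n => primaryFactor (y n j * z)) atTop
      (𝓝 (primaryFactor (x j * z))) := by
    have hcont : Continuous fun r : ℝ => primaryFactor (r * z) := by
      unfold primaryFactor
      fun_prop
    exact (hcont.tendsto _).comp (hyx j)
  have hbound (n j : ℕ) : ‖primaryFactor (y n j * z) - 1‖ ≤
      3 * Real.exp (M * ‖z‖) * ((M * ‖z‖) ^ 2 * (1 / ((j : ℝ) + 1) ^ 2)) := by
    have hnorm : ‖(y n j : ℂ) * z‖ ≤ M * ‖z‖ * (1 / (j + 1)) := by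
      rw [norm_mul, Complex.norm_real, Real.norm_of_nonneg (hy₀ n j), mul_right_comm,
        mul_one_div]
      gcongr
      exact hyM n j
    have hnorm' : ‖(y n j : ℂ) * z‖ ≤ M * ‖z‖ := hnorm.trans <|
      mul_le_of_le_one_right (by positivity) ((div_le_one₀ (by positivity)).2 (by simp))
    refine (norm_primaryFactor_sub_one_le _).trans ?_
    rw [← one_div_pow, ← mul_pow]
    gcongr
  simpa using tendsto_tprod_one_add_of_dominated_convergence hmajorant
    (fun j => (hfactor j).sub_const 1) (Eventually.of_forall hbound)

theorem tprod_primaryFactor {x : ℕ → ℝ} (hx : Summable x) (z : ℂ) :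
    ∏' j, primaryFactor (x j * z) =
      (∏' j, (1 - x j * z)) * Complex.exp (((∑' j, x j : ℝ) : ℂ) * z) := by
  have hexp := ((Complex.hasSum_ofReal.2 hx.hasSum).mul_right z).cexp
  exact ((multipliable_one_sub_mul (by simpa using hx.norm) z).hasProd.mul hexp).tprod_eq

theorem tprod_one_sub_mul_eq_exp_mul_tprod_primaryFactor {x : ℕ → ℝ} (hx : Summable x) (z : ℂ) :
    ∏' j, (1 - x j * z) =
      Complex.exp (-((∑' j, x j : ℝ) : ℂ) * z) * ∏' j, primaryFactor (x j * z) := by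
  rw [tprod_primaryFactor hx, mul_left_comm, ← Complex.exp_add, neg_mul, neg_add_cancel,
    Complex.exp_zero, mul_one]

end PrimaryFactors

section NormalFamilies

theorem tendsto_polyFun_recProd {Y : ℕ → Multiset ℝ} {S M : ℝ} {x : ℕ → ℝ}
    (hY : ∀ n, ∀ y ∈ Y n, 0 ≤ y) (hYM : ∀ n, (Y n).sum ≤ M)
    (hS : Tendsto (fun n => (Y n).sum) atTop (𝓝 S))
    (hx : ∀ j, Tendsto (fun n => decreasingSeq (Y n) j) atTop (𝓝 (x j))) (hxsum : Summable x)
    (z : ℂ) :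
    Tendsto (fun n => polyFun (recProd (Y n)) z) atTop
      (𝓝 (Complex.exp (-(S - ∑' j, x j : ℝ) * z) * ∏' j, (1 - x j * z))) := by
  have hexp : Tendsto (fun n => Complex.exp (-((Y n).sum : ℂ) * z)) atTop
      (𝓝 (Complex.exp (-(S : ℂ) * z))) := by
    have hcont : Continuous fun r : ℝ => Complex.exp (-(r : ℂ) * z) := by fun_prop
    exact (hcont.tendsto S).comp hS
  have hprod : Tendsto (fun n => ∏' j, primaryFactor (decreasingSeq (Y n) j * z)) atTop
      (𝓝 (∏' j, primaryFactor (x j * z))) :=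
    tendsto_tprod_primaryFactor (fun n => decreasingSeq_nonneg (hY n)) (fun n j =>
      (decreasingSeq_le_sum_div (hY n) j).trans (by gcongr; exact hYM n)) hx z
  convert hexp.mul hprod using 2 with n
  · rw [polyFun_recProd, tprod_one_sub_mul_eq_exp_mul_tprod_primaryFactor
      (hasSum_decreasingSeq _).summable, (hasSum_decreasingSeq _).tsum_eq]
  · rw [tprod_primaryFactor hxsum, mul_left_comm, ← Complex.exp_add, mul_comm]
    congr 2
    push_cast
    ring

theorem exists_subseq_tendsto_polyFun_recProd {Y : ℕ → Multiset ℝ} {M : ℝ}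
    (hY : ∀ n, ∀ y ∈ Y n, 0 ≤ y) (hYM : ∀ n, (Y n).sum ≤ M) :
    ∃ (φ : ℕ → ℕ) (α : ℝ) (x : ℕ → ℝ), StrictMono φ ∧ 0 ≤ α ∧ (∀ j, 0 ≤ x j) ∧ Summable x ∧
      ∀ z, Tendsto (fun n => polyFun (recProd (Y (φ n))) z) atTop
        (𝓝 (Complex.exp (-α * z) * ∏' j, (1 - x j * z))) := by
  have hy₀ (n j : ℕ) : 0 ≤ decreasingSeq (Y n) j := decreasingSeq_nonneg (hY n) j
  have hyM (n j : ℕ) : decreasingSeq (Y n) j ≤ M / (j + 1) :=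
    (decreasingSeq_le_sum_div (hY n) j).trans (by gcongr; exact hYM n)
  have hcompact : IsCompact (Set.Icc 0 M ×ˢ
      Set.univ.pi fun j : ℕ => Set.Icc (0 : ℝ) (M / (j + 1))) :=
    isCompact_Icc.prod (isCompact_univ_pi fun _ => isCompact_Icc)
  obtain ⟨⟨S, x⟩, -, φ, hφ, hlim⟩ := hcompact.tendsto_subseq
    (x := fun n => ((Y n).sum, decreasingSeq (Y n))) fun n =>
      ⟨⟨Multiset.sum_nonneg (hY n), hYM n⟩, fun j _ => ⟨hy₀ n j, hyM n j⟩⟩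
  have hS : Tendsto (fun n => (Y (φ n)).sum) atTop (𝓝 S) := hlim.fst_nhds
  have hx (j : ℕ) : Tendsto (fun n => decreasingSeq (Y (φ n)) j) atTop (𝓝 (x j)) :=
    tendsto_pi_nhds.1 hlim.snd_nhds j
  have hx₀ (j : ℕ) : 0 ≤ x j := ge_of_tendsto' (hx j) fun n => hy₀ (φ n) j
  have hxS (m : ℕ) : ∑ j ∈ Finset.range m, x j ≤ S :=
    le_of_tendsto_of_tendsto' (tendsto_finsetSum _ fun j _ => hx j) hS fun n =>
      sum_le_hasSum _ (fun j _ => hy₀ (φ n) j) (hasSum_decreasingSeq _)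
  have hxsum : Summable x := summable_of_sum_range_le hx₀ hxS
  -- The mass `S - ∑' j, x j` lost in the limit is what produces the exponential factor.
  refine ⟨φ, S - ∑' j, x j, x, hφ, sub_nonneg.2 (Real.tsum_le_of_sum_range_le hx₀ hxS), hx₀,
    hxsum, tendsto_polyFun_recProd (fun n => hY (φ n)) (fun n => hYM (φ n)) hS hx hxsum⟩

theorem exists_subseq_tendsto_polyFun_of_natDegree_le {R : ℕ → ℝ[X]} {B : ℕ} {c : ℕ → ℝ}
    (hdeg : ∀ n, (R n).natDegree ≤ B) (hc : ∀ n k, |(R n).coeff k| ≤ c k) :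
    ∃ (φ : ℕ → ℕ) (Q : ℝ[X]), StrictMono φ ∧
      ∀ z, Tendsto (fun n => polyFun (R (φ n)) z) atTop (𝓝 (polyFun Q z)) := by
  have hcompact : IsCompact (Set.univ.pi fun k : ℕ => Set.Icc (-c k) (c k)) :=
    isCompact_univ_pi fun _ => isCompact_Icc
  obtain ⟨q, -, φ, hφ, hlim⟩ := hcompact.tendsto_subseq (x := fun n => (R n).coeff)
    fun n k _ => abs_le.1 (hc n k)
  refine ⟨φ, ∑ k ∈ Finset.range (B + 1), monomial k (q k), hφ, fun z => ?_⟩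
  have hR (n : ℕ) : polyFun (R n) z = ∑ k ∈ Finset.range (B + 1), ((R n).coeff k : ℂ) * z ^ k := by
    simp [polyFun, aeval_eq_sum_range' (Nat.lt_succ_of_le (hdeg n))]
  have hQ : polyFun (∑ k ∈ Finset.range (B + 1), monomial k (q k)) z =
      ∑ k ∈ Finset.range (B + 1), (q k : ℂ) * z ^ k := by
    simp [polyFun, aeval_monomial]
  simp only [hR, hQ]
  exact tendsto_finsetSum _ fun k _ => ((Complex.continuous_ofReal.tendsto _).comp
    (tendsto_pi_nhds.1 hlim k)).mul_const _

theorem mem_LPHalfLineStar_of_tendsto_recProd_mul {Y : ℕ → Multiset ℝ} {R : ℕ → ℝ[X]} {B : ℕ}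
    {M : ℝ} {c : ℕ → ℝ} {G : ℂ → ℂ} (hY : ∀ n, ∀ y ∈ Y n, 0 ≤ y) (hYM : ∀ n, (Y n).sum ≤ M)
    (hdeg : ∀ n, (R n).natDegree ≤ B) (hc : ∀ n k, |(R n).coeff k| ≤ c k)
    (hG : ∀ z, Tendsto (fun n => polyFun (recProd (Y n) * R n) z) atTop (𝓝 (G z))) :
    G ∈ LPHalfLineStar := by
  obtain ⟨φ, α, x, hφ, hα, hx₀, hx, hrecProd⟩ := exists_subseq_tendsto_polyFun_recProd hY hYM
  obtain ⟨ψ, Q, hψ, hR⟩ := exists_subseq_tendsto_polyFun_of_natDegree_le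
    (fun n => hdeg (φ n)) fun n => hc (φ n)
  refine mem_LPHalfLineStar_iff.2 ⟨Q, α, ℕ, x, hα, hx₀, hx, fun z => ?_⟩
  have hlim := (hR z).mul ((hrecProd z).comp hψ.tendsto_atTop)
  refine tendsto_nhds_unique (((hG z).comp (hφ.comp hψ).tendsto_atTop).congr fun n => ?_) hlim
  simp only [Function.comp_apply, polyFun, map_mul, mul_comm]

end NormalFamilies

section ClosureProperties

theorem mem_LPHalfLineStar_of_forall_expMajorized {B : ℕ} {f : ℕ → ℝ[X]} {F : ℂ → ℂ} {A T δ : ℝ}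
    (hB : ∀ n, zeroCount (f n) halfLineᶜ ≤ B) (hf : ∀ n, ExpMajorized A T (f n).coeff)
    (hδ : 0 < δ) (hf₀ : ∀ n, δ ≤ |(f n).coeff 0|)
    (hF : ∀ z, Tendsto (fun n => polyFun (f n) z) atTop (𝓝 (F z))) : F ∈ LPHalfLineStar := by
  obtain ⟨M, hM, hfactor⟩ :=
    exists_bound_normalized_factorization B fun k => A * (T ^ k / k.factorial) / δ
  choose Y R hY hYM hdeg hYR hR using fun n => hfactor (f n) (hB n)
    (abs_pos.1 (hδ.trans_le (hf₀ n))) fun k => by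
      have hk : 0 ≤ A * (T ^ k / k.factorial) := (abs_nonneg _).trans (hf n k)
      calc |(f n).coeff k| ≤ A * (T ^ k / k.factorial) / δ * δ := by
            rw [div_mul_cancel₀ _ hδ.ne']
            exact hf n k
        _ ≤ A * (T ^ k / k.factorial) / δ * |(f n).coeff 0| := by
            gcongr
            exact hf₀ n
  refine mem_LPHalfLineStar_of_tendsto_recProd_mul (c := fun k => A * (M ^ k / k.factorial))
    hY hYM hdeg (fun n k => (hR n k).trans ?_) fun z => ?_
  · gcongr
    simpa using hf n 0
  · simpa only [← hYR] using hF z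

theorem mem_LPHalfLineStar_of_tendsto_of_zero_ne_zero {B : ℕ} {f : ℕ → ℝ[X]} {F : ℂ → ℂ} {A T : ℝ}
    (hB : ∀ n, zeroCount (f n) halfLineᶜ ≤ B)
    (hf : ∀ᶠ n in atTop, ExpMajorized A T (f n).coeff)
    (hF : ∀ z, Tendsto (fun n => polyFun (f n) z) atTop (𝓝 (F z))) (hF₀ : F 0 ≠ 0) :
    F ∈ LPHalfLineStar := by
  have hnorm : 0 < ‖F 0‖ := norm_pos_iff.2 hF₀
  have hcoeff (p : ℝ[X]) : ‖polyFun p 0‖ = |p.coeff 0| := by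
    rw [polyFun, ← coeff_zero_eq_aeval_zero', Complex.coe_algebraMap, Complex.norm_real,
      Real.norm_eq_abs]
  have hlow : ∀ᶠ n in atTop, ‖F 0‖ / 2 ≤ |(f n).coeff 0| := by
    simpa only [hcoeff] using (hF 0).norm.eventually_const_le (half_lt_self hnorm)
  obtain ⟨N, hN⟩ := eventually_atTop.1 (hf.and hlow)
  exact mem_LPHalfLineStar_of_forall_expMajorized (fun n => hB (n + N))
    (fun n => (hN (n + N) (N.le_add_left n)).1) (half_pos hnorm)
    (fun n => (hN (n + N) (N.le_add_left n)).2) fun z => (tendsto_add_atTop_iff_nat N).2 (hF z)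

theorem mem_LPHalfLineStar_of_tendsto {B : ℕ} {f : ℕ → ℝ[X]} {F : ℂ → ℂ} {A T t : ℝ}
    (hB : ∀ n, zeroCount (f n) halfLineᶜ ≤ B)
    (hf : ∀ᶠ n in atTop, ExpMajorized A T (f n).coeff)
    (hF : ∀ z, Tendsto (fun n => polyFun (f n) z) atTop (𝓝 (F z)))
    (ht : 0 ≤ t) (hFt : F (-t) ≠ 0) : F ∈ LPHalfLineStar := by
  have hshift : (fun z => F (z + (-t : ℝ))) ∈ LPHalfLineStar :=
    mem_LPHalfLineStar_of_tendsto_of_zero_ne_zero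
      (fun n => (zeroCount_taylor_neg_le (f n) ht).trans (hB n))
      (hf.mono fun n hn => hn.taylor (-t))
      (fun z => by simpa only [polyFun_taylor] using hF (z + (-t : ℝ))) (by simpa using hFt)
  simpa using comp_add_mem_LPHalfLineStar hshift t

theorem exists_neg_ne_zero_of_represents {g : PowerSeries ℂ} {F : ℂ → ℂ} (hF : Represents g F)
    {k : ℕ} (hk : PowerSeries.coeff k g ≠ 0) : ∃ t : ℝ, 0 < t ∧ F (-t) ≠ 0 := by
  set q := FormalMultilinearSeries.ofScalars ℂ fun k => PowerSeries.coeff k g with hq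
  have hcoeff (k : ℕ) : q.coeff k = PowerSeries.coeff k g := by
    simp [hq, FormalMultilinearSeries.coeff_ofScalars]
  have hseries : HasFPowerSeriesAt F q 0 := hasFPowerSeriesAt_iff.2 <|
    Eventually.of_forall fun z => by simpa [hcoeff, mul_comm] using hF z
  rcases hseries.analyticAt.eventually_eq_zero_or_eventually_ne_zero with hzero | hne
  · have hq0 : q = 0 := (hseries.congr hzero).eq_zero
    exact absurd (by rw [← hcoeff, hq0]; rfl) hk
  · have hneg : Tendsto (fun t : ℝ => -(t : ℂ)) (𝓝[>] 0) (𝓝[≠] 0) := by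
      refine tendsto_nhdsWithin_iff.2 ⟨?_, ?_⟩
      · have hcont : Continuous fun t : ℝ => -(t : ℂ) := by fun_prop
        simpa using (hcont.tendsto 0).mono_left nhdsWithin_le_nhds
      · filter_upwards [self_mem_nhdsWithin] with t ht
        simpa using ne_of_gt ht
    obtain ⟨t, hFt, ht⟩ := ((hneg.eventually hne).and self_mem_nhdsWithin).exists
    exact ⟨t, ht, hFt⟩

end ClosureProperties

theorem theorem3p4 (f : ℕ → ℝ[X]) (g : PowerSeries ℂ)
    (hweak : ConvergesWeakly (fun n => polyFun (f n)) g)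
    (hne : ∃ k : ℕ, PowerSeries.coeff k g ≠ 0)
    (hbdd : ∃ B : ℕ, ∀ n : ℕ, zeroCount (f n) halfLineᶜ ≤ B) :
    ∃ F : ℂ → ℂ, Represents g F ∧ F ∈ LPHalfLineStar ∧
      ConvergesStrongly (fun n => polyFun (f n)) F := by
  obtain ⟨B, hB⟩ := hbdd
  obtain ⟨k, hk⟩ := hne
  obtain ⟨A, T, -, hf⟩ :=
    exists_eventually_expMajorized hB (convergesWeakly_polyFun_iff.1 hweak) hk
  obtain ⟨F, hrep, hstrong⟩ := ExpMajorized.exists_represents_convergesStrongly hweak hf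
  obtain ⟨t, ht, hFt⟩ := exists_neg_ne_zero_of_represents hrep hk
  have hpointwise (z : ℂ) : Tendsto (fun n => polyFun (f n) z) atTop (𝓝 (F z)) :=
    (hstrong {z} isCompact_singleton).tendsto_at rfl
  exact ⟨F, hrep, mem_LPHalfLineStar_of_tendsto hB hf hpointwise ht.le hFt, hstrong⟩
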